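/- Let $V$ be a finite-dimensional real vector space, let $m\ge 0$ and $d\ge 1$ be integers, and let $p_1,\dots,p_d$ be positive real numbers with $p_1+\cdots+p_d=1$. Let $(A_i^{(1)},\dots,A_i^{(d)})$, $i=1,\dots,m$, be $d$-tuples of subspaces of $V$ forming a skew Bollobás system, that is: (i) for every $i\in\{1,\dots,m\}$, $\dim\bigl(A_i^{(1)}+\cdots+A_i^{(d)}\bigr)=\dim A_i^{(1)}+\cdots+\dim A_i^{(d)}$; (ii) for all $1\le i<j\le m$ there exist $1\le p<q\le d$ such that $\dim\bigl(A_i^{(p)}\cap A_j^{(q)}\bigr)>0$. Then $$\sum_{i=1}^{m}\prod_{\ell=1}^{d}p_\ell^{\dim A_i^{(\ell)}}\le 1.$$ -/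

import Mathlib

/-- A family `A i = (A i 0, …, A i (d-1))`, `i < m`, of `d`-tuples of subspaces of a real vector
space `V` (meant to be finite-dimensional) is a skew Bollobás system if the sum of the members of
each tuple has dimension the sum of their dimensions, and for all `i < j` there are `p < q` such
that the `p`-th member of tuple `i` and the `q`-th member of tuple `j` intersect nontrivially. -/
structure IsSkewBollobasSystem {V : Type*} [AddCommGroup V] [Module ℝ V] {m d : ℕ}
    (A : Fin m → Fin d → Submodule ℝ V) : Prop where
  finrank_iSup : ∀ i : Fin m,
    Module.finrank ℝ (⨆ l : Fin d, A i l : Submodule ℝ V) = ∑ l : Fin d, Module.finrank ℝ (A i l)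
  finrank_inf_pos : ∀ i j : Fin m, i < j → ∃ p q : Fin d, p < q ∧
    0 < Module.finrank ℝ (A i p ⊓ A j q : Submodule ℝ V)

/-! Choose a basis of `V` adapted to each tuple and colour its vectors by the subspace containing
them; vectors outside the sum stay uncoloured. As the `p l` sum to 1, the weight of a tuple is the
total weight of all completions of its colouring. Completions with prescribed colour counts `a`
again form a skew system, so `card_le_multinomial_of_lex` bounds their number by the multinomial
coefficient of `a`. Summing over `a` gives at most `(∑ l, p l) ^ n = 1`, where `n = dim V`. -/

/-! ### General position and determinant pairings -/

-- A generic `T` works: for each `i` the determinant is a polynomial in the entries of `T`, nonzero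
-- because a left inverse gives it the value 1. Over an infinite field the product of these
-- polynomials has a nonzero value.
open Module in
theorem exists_forall_linearIndependent_comp {K V ι κ : Type*} [Field K] [Infinite K]
    [AddCommGroup V] [Module K V] [FiniteDimensional K V] [Finite ι] [Finite κ]
    (v : ι → κ → V) (hv : ∀ i, LinearIndependent K (v i)) :
    ∃ T : V →ₗ[K] (κ → K), ∀ i, LinearIndependent K (T ∘ v i) := by
  classical
  have := Fintype.ofFinite ι
  have := Fintype.ofFinite κ
  let b := finBasis K V
  let L : (κ × Fin (finrank K V) → K) → V →ₗ[K] (κ → K) := fun t =>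
    LinearMap.pi fun r => ∑ y, t (r, y) • b.coord y
  let P : ι → Matrix κ κ (MvPolynomial (κ × Fin (finrank K V)) K) := fun i =>
    Matrix.of fun k r => ∑ y, MvPolynomial.X (r, y) * MvPolynomial.C (b.coord y (v i k))
  have heval : ∀ i t, MvPolynomial.eval t (P i).det = (Matrix.of fun k => L t (v i k)).det := by
    intro i t
    rw [RingHom.map_det]
    congr 1
    ext k r
    simp [P, L]
  have hsurj : ∀ T : V →ₗ[K] (κ → K), ∃ t, L t = T := by
    intro T
    refine ⟨fun ry => T (b ry.2) ry.1, b.ext fun y => ?_⟩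
    ext r
    simp [L, Finsupp.single_apply]
  have hne : ∀ i, (P i).det ≠ 0 := by
    intro i h0
    have hinj : LinearMap.ker (Fintype.linearCombination K (v i)) = ⊥ :=
      LinearMap.ker_eq_bot.2 (hv i).fintypeLinearCombination_injective
    obtain ⟨T, hT⟩ := LinearMap.exists_leftInverse_of_injective _ hinj
    obtain ⟨t, rfl⟩ := hsurj T
    have h1 := heval i t
    have h2 : (Matrix.of fun k => L t (v i k)) = 1 := by
      ext k r
      have := congrFun (LinearMap.congr_fun hT (Pi.single k 1)) r
      simp only [LinearMap.comp_apply, Fintype.linearCombination_apply_single, one_smul,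
        LinearMap.id_apply] at this
      rw [Matrix.of_apply, this, Matrix.one_apply, Pi.single_apply]
      simp [eq_comm]
    rw [h0, h2] at h1
    simp at h1
  have hprod : ∏ i, (P i).det ≠ 0 := Finset.prod_ne_zero_iff.2 fun i _ => hne i
  obtain ⟨t, ht⟩ : ∃ t, MvPolynomial.eval t (∏ i, (P i).det) ≠ 0 := by
    by_contra! h
    exact hprod (MvPolynomial.funext fun t => by simpa using h t)
  refine ⟨L t, fun i => ?_⟩
  rw [map_prod, Finset.prod_ne_zero_iff] at ht
  have := ht i (Finset.mem_univ i)
  rw [heval] at this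
  exact Matrix.linearIndependent_rows_of_det_ne_zero this

/-- The determinant, as an alternating function of some of its rows. -/
noncomputable def detRowsInl {K α β : Type*} [CommRing K] [Fintype α] [D : DecidableEq α]
    [Fintype β] [DecidableEq β] (w : β → α ⊕ β → K) : (α ⊕ β → K) [⋀^α]→ₗ[K] K where
  toFun v := (Matrix.of (Sum.elim v w)).det
  map_update_add' {D'} v i x y := by
    obtain rfl : D' = D := Subsingleton.elim _ _
    rw [← Sum.update_elim_inl, ← Sum.update_elim_inl, ← Sum.update_elim_inl]
    exact Matrix.det_updateRow_add (Matrix.of (Sum.elim v w)) (Sum.inl i) x y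
  map_update_smul' {D'} v i c x := by
    obtain rfl : D' = D := Subsingleton.elim _ _
    rw [← Sum.update_elim_inl, ← Sum.update_elim_inl]
    exact Matrix.det_updateRow_smul (Matrix.of (Sum.elim v w)) (Sum.inl i) c x
  map_eq_zero_of_eq' v i j hv hij :=
    Matrix.det_zero_of_row_eq (M := Matrix.of (Sum.elim v w))
      (i := Sum.inl i) (j := Sum.inl j) (fun h => hij (Sum.inl_injective h)) hv

-- The determinant is alternating in its first `a` rows, hence a linear functional on the `a`-th
-- exterior power, of dimension `(a + b).choose a`.
open Module in
theorem exists_det_elim_eq_sum {K ι : Type*} [Field K] {a b : ℕ}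
    (u : ι → Fin a → Fin a ⊕ Fin b → K) (w : ι → Fin b → Fin a ⊕ Fin b → K) :
    ∃ (x : ι → Fin ((a + b).choose a) → K) (y : ι → Fin ((a + b).choose a) → K),
      ∀ i j, (Matrix.of (Sum.elim (u i) (w j))).det = ∑ k, x i k * y j k := by
  have hr : finrank K (⋀[K]^a (Fin a ⊕ Fin b → K)) = (a + b).choose a := by
    rw [exteriorPower.finrank_eq]; simp
  let B := finBasisOfFinrankEq K _ hr
  refine ⟨fun i k => B.repr (exteriorPower.ιMulti K a (u i)) k,
    fun j k => exteriorPower.alternatingMapLinearEquiv (detRowsInl (w j)) (B k), fun i j => ?_⟩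
  have h := exteriorPower.alternatingMapLinearEquiv_apply_ιMulti (detRowsInl (w j)) (u i)
  rw [← B.sum_repr (exteriorPower.ιMulti K a (u i)), map_sum] at h
  simp only [map_smul, smul_eq_mul] at h
  exact h.symm

theorem exists_sum_mul_of_linearIndependent {K V ι : Type*} [Field K] [Infinite K]
    [AddCommGroup V] [Module K V] [FiniteDimensional K V] [Finite ι] {a b : ℕ}
    (u : ι → Fin a → V) (w : ι → Fin b → V)
    (h : ∀ i, LinearIndependent K (Sum.elim (u i) (w i))) :
    ∃ (x : ι → Fin ((a + b).choose a) → K) (y : ι → Fin ((a + b).choose a) → K),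
      (∀ i, ∑ k, x i k * y i k ≠ 0) ∧
      ∀ i j, ¬ Disjoint (Submodule.span K (Set.range (u i))) (Submodule.span K (Set.range (w j))) →
        ∑ k, x i k * y j k = 0 := by
  obtain ⟨T, hT⟩ := exists_forall_linearIndependent_comp _ h
  obtain ⟨x, y, hxy⟩ := exists_det_elim_eq_sum (fun i => T ∘ u i) (fun i => T ∘ w i)
  refine ⟨x, y, fun i => ?_, fun i j hij => ?_⟩
  · rw [← hxy, ← isUnit_iff_ne_zero, ← Matrix.isUnit_iff_isUnit_det,
      ← Matrix.linearIndependent_rows_iff_isUnit]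
    have := hT i
    rwa [Sum.comp_elim] at this
  · rw [← hxy]
    by_contra hne
    have := Matrix.linearIndependent_rows_of_det_ne_zero hne
    have h2 : LinearIndependent K (T ∘ Sum.elim (u i) (w j)) := by
      rw [Sum.comp_elim]; exact this
    exact hij (linearIndependent_sum.1 h2.of_comp).2.2

theorem Matrix.card_le_card_of_triangular {K ι κ : Type*} [Field K] [LinearOrder ι] [Fintype ι]
    [Fintype κ] (X Y : Matrix ι κ K) (hd : ∀ i, ∑ k, X i k * Y i k ≠ 0)
    (ht : ∀ i j, i < j → ∑ k, X i k * Y j k = 0) : Fintype.card ι ≤ Fintype.card κ := by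
  have hM : IsUnit (X * Y.transpose) := by
    rw [Matrix.isUnit_iff_isUnit_det, Matrix.det_of_isLowerTriangular, isUnit_iff_ne_zero]
    · exact Finset.prod_ne_zero_iff.2 fun i _ => hd i
    · intro i j hij
      exact ht i j hij
  rw [← Matrix.rank_of_isUnit _ hM]
  exact (Matrix.rank_mul_le_left _ _).trans (Matrix.rank_le_card_width _)

/-! ### Counting tuples of fixed dimensions -/

-- For each `l`, pair the span of colour `l` with the span of all larger colours. The product over
-- `l` of these pairings is nonzero on the diagonal; for `i < j` the factor at `l = p` vanishes. The
-- binomials bound the rank.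
open Finset in
theorem card_le_prod_choose {K V ι : Type*} [Field K] [Infinite K] [AddCommGroup V] [Module K V]
    [FiniteDimensional K V] [LinearOrder ι] [Fintype ι] {n d : ℕ} (a : Fin d → ℕ)
    (e : ι → Fin n → V) (he : ∀ i, LinearIndependent K (e i)) (c : ι → Fin n → Fin d)
    (hc : ∀ i l, #{x | c i x = l} = a l)
    (h : ∀ i j, i < j → ∃ p q, p < q ∧ ¬ Disjoint (Submodule.span K (e i '' {x | c i x = p}))
      (Submodule.span K (e j '' {x | c j x = q}))) :
    Fintype.card ι ≤ ∏ l, (a l + ∑ k ∈ Ioi l, a k).choose (a l) := by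
  have hc' : ∀ i l, #{x | l < c i x} = ∑ k ∈ Ioi l, a k := by
    intro i l
    rw [Finset.card_eq_sum_card_fiberwise (f := c i) (t := Ioi l) (by intro x; simp)]
    refine Finset.sum_congr rfl fun k hk => ?_
    rw [← hc i k, Finset.filter_filter]
    congr 1
    ext x
    simp only [mem_Ioi] at hk
    simp only [mem_filter, mem_univ, true_and, and_iff_right_iff_imp]
    rintro rfl
    exact hk
  let s : ∀ i l, Fin (a l) ↪o Fin n := fun i l => orderEmbOfFin _ (hc i l)
  let t : ∀ i l, Fin (∑ k ∈ Ioi l, a k) ↪o Fin n := fun i l => orderEmbOfFin _ (hc' i l)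
  have hs : ∀ i l, Set.range (s i l) = {x | c i x = l} := fun i l => by
    simp [s]
  have ht : ∀ i l, Set.range (t i l) = {x | l < c i x} := fun i l => by
    simp [t]
  have hst : ∀ l i, LinearIndependent K (Sum.elim (e i ∘ s i l) (e i ∘ t i l)) := by
    intro l i
    rw [← Sum.comp_elim]
    refine (he i).comp _ ((s i l).injective.sumElim (t i l).injective fun x y hxy => ?_)
    have h1 : s i l x ∈ {x | c i x = l} := hs i l ▸ Set.mem_range_self x
    have h2 : t i l y ∈ {x | l < c i x} := ht i l ▸ Set.mem_range_self y
    rw [hxy] at h1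
    exact (ne_of_gt h2) h1
  choose x y hxy hxy0 using fun l => exists_sum_mul_of_linearIndependent
    (fun i => e i ∘ s i l) (fun i => e i ∘ t i l) (hst l)
  have hmul : ∀ i j, ∑ f : (∀ l : Fin d, Fin ((a l + ∑ k ∈ Ioi l, a k).choose (a l))),
      (∏ l, x l i (f l)) * (∏ l, y l j (f l)) = ∏ l, ∑ k, x l i k * y l j k := by
    intro i j
    simp_rw [← Finset.prod_mul_distrib]
    rw [Finset.prod_univ_sum, Fintype.piFinset_univ]
  have := Matrix.card_le_card_of_triangular
    (κ := ∀ l : Fin d, Fin ((a l + ∑ k ∈ Ioi l, a k).choose (a l)))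
    (fun i f => ∏ l, x l i (f l)) (fun i f => ∏ l, y l i (f l)) (fun i => by
      rw [hmul]
      exact Finset.prod_ne_zero_iff.2 fun l _ => hxy l i) (fun i j hij => by
      rw [hmul]
      obtain ⟨p, q, hpq, hdis⟩ := h i j hij
      refine Finset.prod_eq_zero (mem_univ p) (hxy0 p i j fun hd => hdis ?_)
      rw [Set.range_comp, Set.range_comp, hs, ht] at hd
      refine hd.mono_right (Submodule.span_mono (Set.image_mono ?_))
      rintro x rfl
      exact hpq)
  simpa using this

open Finset in
theorem Fin.prod_choose_eq_multinomial {d : ℕ} (a : Fin d → ℕ) :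
    ∏ l, (a l + ∑ k ∈ Ioi l, a k).choose (a l) = Nat.multinomial univ a := by
  induction d with
  | zero => simp
  | succ d ih =>
    rw [Fin.prod_univ_succ, Fin.univ_succ, Nat.multinomial_cons, Fin.sum_Ioi_zero]
    congr 1
    · simp
    · simp only [Fin.sum_Ioi_succ]
      rw [ih fun l => a l.succ]
      simp [Nat.multinomial]

/-! ### Adapted bases and weighted count of colourings -/

open Module in
theorem exists_linearIndependent_span_image_eq {K V : Type*} [Field K] [AddCommGroup V]
    [Module K V] [FiniteDimensional K V] {d : ℕ} (A : Fin d → Submodule K V)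
    (hA : finrank K (⨆ l, A l : Submodule K V) = ∑ l, finrank K (A l)) :
    ∃ (e : Fin (finrank K V) → V) (g : Fin (finrank K V) → Option (Fin d)),
      LinearIndependent K e ∧ (∀ l, Submodule.span K (e '' {x | g x = some l}) = A l) ∧
      ∀ l, Finset.card {x | g x = some l} = finrank K (A l) := by
  let v : (Σ l, Fin (finrank K (A l))) → V := fun s => finBasis K (A s.1) s.2
  have hspan : ∀ l, Submodule.span K (Set.range fun k => v ⟨l, k⟩) = A l := by
    intro l
    have : (Set.range fun k => v ⟨l, k⟩) = (A l).subtype '' Set.range (finBasis K (A l)) := by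
      rw [← Set.range_comp]; rfl
    rw [this, Submodule.span_image, Basis.span_eq, Submodule.map_subtype_top]
  have hv : LinearIndependent K v := by
    rw [linearIndependent_iff_card_eq_finrank_span, Set.finrank]
    have : Submodule.span K (Set.range v) = ⨆ l, A l := by
      rw [Set.range_sigma_eq_iUnion_range, Submodule.span_iUnion]
      exact iSup_congr hspan
    rw [this, hA]
    simp
  let b := Basis.sumExtend hv
  let σ := b.indexEquiv (finBasis K V)
  have hb : ∀ s, b (Sum.inl s) = v s := fun s => by
    simp only [b, Basis.sumExtend, Basis.reindex_apply, Basis.extend_apply_self]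
    rfl
  have hset : ∀ l, {x | (σ.symm x).elim (fun s => some s.1) (fun _ => none) = some l} =
      Set.range fun k => σ (Sum.inl ⟨l, k⟩) := by
    intro l
    ext x
    obtain ⟨y, rfl⟩ := σ.surjective x
    rcases y with ⟨l', k⟩ | y
    · simp only [Set.mem_ofPred_eq, Equiv.symm_apply_apply, Sum.elim_inl, Option.some.injEq,
        Set.mem_range, EmbeddingLike.apply_eq_iff_eq, Sum.inl.injEq]
      constructor
      · rintro rfl
        exact ⟨k, rfl⟩
      · rintro ⟨k', hk⟩
        exact (congrArg Sigma.fst hk).symm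
    · simp
  refine ⟨b.reindex σ, fun x => (σ.symm x).elim (fun s => some s.1) (fun _ => none),
    (b.reindex σ).linearIndependent, fun l => ?_, fun l => ?_⟩
  · rw [hset, ← Set.range_comp]
    refine Eq.trans ?_ (hspan l)
    congr 2
    ext k
    simp [hb]
  · rw [← Set.ncard_coe_finset]
    simp only [Finset.coe_filter, Finset.mem_univ, true_and]
    rw [hset, Set.ncard_eq_toFinset_card', Set.toFinset_range, Finset.card_image_of_injective]
    · simp
    · intro k k' hk
      simpa using hk

open Finset in
theorem card_le_multinomial_of_lex {K V : Type*} [Field K] [Infinite K] [AddCommGroup V]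
    [Module K V] [FiniteDimensional K V] {n m d : ℕ} (a : Fin d → ℕ)
    (S : Finset (Fin m × (Fin n → Fin d))) (e : Fin m → Fin n → V)
    (he : ∀ i, LinearIndependent K (e i)) (hS : ∀ z ∈ S, ∀ l, #{x | z.2 x = l} = a l)
    (h : ∀ z ∈ S, ∀ z' ∈ S, z.1 < z'.1 → ∃ p q, p < q ∧
      ¬ Disjoint (Submodule.span K (e z.1 '' {x | z.2 x = p}))
        (Submodule.span K (e z'.1 '' {x | z'.2 x = q}))) :
    #S ≤ Nat.multinomial univ a := by
  let f : S → Fin m ×ₗ Lex (Fin n → Fin d) := fun z => toLex (z.1.1, toLex z.1.2)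
  have hf : Function.Injective f := by
    rintro ⟨⟨i, c⟩, h⟩ ⟨⟨j, c'⟩, h'⟩ hij
    simpa [f] using hij
  let : LinearOrder S := LinearOrder.lift' f hf
  rw [← Fin.prod_choose_eq_multinomial, ← Fintype.card_coe]
  refine card_le_prod_choose a (fun z : S => e z.1.1) (fun z => he _) (fun z => z.1.2)
    (fun z => hS z.1 z.2) ?_
  rintro ⟨⟨i, c⟩, hz⟩ ⟨⟨j, c'⟩, hz'⟩ hlt
  have hlt' : toLex (i, toLex c) < toLex (j, toLex c') := hlt
  rw [Prod.Lex.toLex_lt_toLex] at hlt'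
  rcases hlt' with hij | ⟨hij, hcc⟩
  · exact h _ hz _ hz' hij
  · simp only at hij hcc
    subst hij
    -- At the first index where the colourings differ, the same basis vector lies in both spans.
    obtain ⟨x, -, hx⟩ := hcc
    refine ⟨c x, c' x, hx, fun hd => ?_⟩
    exact (he i).ne_zero x (Submodule.disjoint_def.1 hd _
      (Submodule.subset_span ⟨x, rfl, rfl⟩) (Submodule.subset_span ⟨x, rfl, rfl⟩))

open Finset in
theorem sum_prod_comp_le_one {n m d : ℕ} (p : Fin d → ℝ) (hp_pos : ∀ l, 0 < p l)
    (hp_sum : ∑ l, p l = 1) (E : Finset (Fin m × (Fin n → Fin d)))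
    (hE : ∀ a : Fin d → ℕ, #{z ∈ E | ∀ l, #{x | z.2 x = l} = a l} ≤ Nat.multinomial univ a) :
    ∑ z ∈ E, ∏ x, p (z.2 x) ≤ 1 := by
  let τ : Fin m × (Fin n → Fin d) → Fin d → ℕ := fun z l => #{x | z.2 x = l}
  have hτ : ∀ z, ∏ x, p (z.2 x) = ∏ l, p l ^ τ z l := fun z => by
    rw [← Finset.prod_fiberwise univ z.2]
    refine Finset.prod_congr rfl fun l _ => Finset.prod_eq_pow_card fun x hx => ?_
    rw [(Finset.mem_filter.1 hx).2]
  have hmem : ∀ z ∈ E, τ z ∈ piAntidiag (univ : Finset (Fin d)) n := by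
    intro z _
    rw [mem_piAntidiag]
    refine ⟨?_, by simp⟩
    simpa using (Finset.card_eq_sum_card_fiberwise (s := univ) (f := z.2) (t := univ)
      (by intro x; simp)).symm
  calc ∑ z ∈ E, ∏ x, p (z.2 x)
      = ∑ a ∈ piAntidiag univ n, ∑ z ∈ E with τ z = a, ∏ l, p l ^ τ z l := by
        simp_rw [hτ]
        exact (Finset.sum_fiberwise_of_maps_to hmem _).symm
    _ ≤ ∑ a ∈ piAntidiag univ n, (Nat.multinomial univ a : ℝ) * ∏ l, p l ^ a l := by
        refine Finset.sum_le_sum fun a _ => ?_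
        have : ∑ z ∈ E with τ z = a, ∏ l, p l ^ τ z l =
            (#{z ∈ E | τ z = a} : ℝ) * ∏ l, p l ^ a l := by
          rw [← nsmul_eq_mul]
          refine Finset.sum_eq_card_nsmul fun z hz => ?_
          rw [(Finset.mem_filter.1 hz).2]
        rw [this]
        have hcard := hE a
        change #{z ∈ E | ∀ l, τ z l = a l} ≤ _ at hcard
        simp only [← funext_iff] at hcard
        refine mul_le_mul_of_nonneg_right (by exact_mod_cast hcard)
          (Finset.prod_nonneg fun l _ => (pow_pos (hp_pos l) _).le)
    _ = 1 := by
        rw [← Finset.sum_pow_eq_sum_piAntidiag, hp_sum, one_pow]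

open Finset in
theorem theorem1p8 {V : Type*} [AddCommGroup V] [Module ℝ V] [FiniteDimensional ℝ V]
    {m d : ℕ} (p : Fin d → ℝ) (hp_pos : ∀ l, 0 < p l) (hp_sum : ∑ l, p l = 1)
    (A : Fin m → Fin d → Submodule ℝ V) (hA : IsSkewBollobasSystem A) :
    ∑ i : Fin m, ∏ l : Fin d, p l ^ Module.finrank ℝ (A i l) ≤ 1 := by
  choose e g he hspan hcard using fun i =>
    exists_linearIndependent_span_image_eq (A i) (hA.finrank_iSup i)
  -- Admissible colours: the forced one, or all of them if the vector is uncoloured.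
  let t : Fin m → Fin (Module.finrank ℝ V) → Finset (Fin d) := fun i x =>
    (g i x).elim univ singleton
  have ht : ∀ i x l k, g i x = some l → k ∈ t i x → k = l := by
    intro i x l k hg hk
    simpa [t, hg] using hk
  let E : Finset (Fin m × (Fin (Module.finrank ℝ V) → Fin d)) :=
    {z | z.2 ∈ Fintype.piFinset (t z.1)}
  have hweight : ∀ i, ∏ l, p l ^ Module.finrank ℝ (A i l) =
      ∑ c ∈ Fintype.piFinset (t i), ∏ x, p (c x) := by
    intro i
    rw [← Finset.prod_univ_sum]
    have : ∀ x, ∑ l ∈ t i x, p l = ∏ l, if g i x = some l then p l else 1 := by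
      intro x
      cases hg : g i x with
      | none => simp [t, hg, hp_sum]
      | some l => simp [t, hg]
    simp_rw [this]
    rw [Finset.prod_comm]
    refine Finset.prod_congr rfl fun l _ => ?_
    rw [← hcard, Finset.prod_ite]
    simp
  have hsum : ∑ i, ∏ l, p l ^ Module.finrank ℝ (A i l) = ∑ z ∈ E, ∏ x, p (z.2 x) := by
    simp_rw [hweight, E, Finset.sum_filter, Fintype.sum_prod_type]
    refine Finset.sum_congr rfl fun i _ => ?_
    rw [← Finset.sum_filter]
    congr 1
    ext c
    simp
  rw [hsum]
  refine sum_prod_comp_le_one p hp_pos hp_sum E fun a => ?_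
  refine card_le_multinomial_of_lex a _ e he (fun z hz => (Finset.mem_filter.1 hz).2) ?_
  intro z hz z' hz' hlt
  have hle : ∀ z ∈ E, ∀ l, A z.1 l ≤ Submodule.span ℝ (e z.1 '' {x | z.2 x = l}) := by
    intro z hz l
    rw [← hspan]
    refine Submodule.span_mono (Set.image_mono fun x hx => ?_)
    exact ht _ _ _ _ hx (Fintype.mem_piFinset.1 (Finset.mem_filter.1 hz).2 x)
  obtain ⟨r, s, hrs, hpos⟩ := hA.finrank_inf_pos z.1 z'.1 hlt
  refine ⟨r, s, hrs, fun hd => ?_⟩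
  have := hd.mono (hle z (Finset.mem_filter.1 hz).1 r) (hle z' (Finset.mem_filter.1 hz').1 s)
  rw [this.eq_bot] at hpos
  simp at hpos
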